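/- **Theorem 5.** There is an absolute constant $R$ such that for every integer $k\ge 1$ and every $\delta>0$ there is a constant $C=C(k,\delta)$ for which the following holds. Let $s,n\ge 1$ be integers, let $0<\varepsilon<1$, and let $s$ servers be given, one of which is designated as the Central Processor (CP). Then there is a randomized protocol with $R$ rounds (in a round, the CP sends a message to each server and then each server sends a message to the CP) such that for all non-negative vectors $a_t=(a_{t1},\dots,a_{tn})\in\mathbb R_{\ge 0}^n$, where $a_t$ is held by server $t$, $t=1,\dots,s$, the CP outputs a number $\tilde A$ with $$\Pr\big[\,|\tilde A-A|\le \varepsilon A\,\big]\ \ge\ 1-\delta,\qquad A=\sum_{i=1}^n\Big(\sum_{t=1}^s a_{ti}\Big)^k ,$$ and in every execution at most $$C\,(s^{k-1}+s^3)\Big(\frac{\ln s}{\varepsilon}\Big)^3$$ words are communicated, so at most $C\,s^{k-1}(\ln s)^3/\varepsilon^3$ words (that is, $\tilde O(s^{k-1}/\varepsilon^3)$) if $k\ge 4$. Neither bound depends on $n$. Here each communicated word is either an index $i\in\{1,\dots,n\}$ or an entry $a_{ti}$ of the vector of the server $t$ that sends it, and the CP communicates free of charge with the server at which it is located. The vector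 $a_t$ need not be written down explicitly at server $t$. The server only uses: an arbitrary approximation of $\sum_i a_{ti}^k$ with relative error at most $\varepsilon/2$; independent random samples, with their entries $a_{ti}$, of indices $i$ drawn with probabilities $a_{ti}^k/\sum_j a_{tj}^k$; and, to send it, the entry $a_{ti}$ at an index $i$ of its choice. -/

import Mathlib

noncomputable section

namespace FreqMoment

/-- A communicated word, as it is received: an index `i ∈ [n]` or a value (an entry of a vector). -/
inductive Word (n : ℕ) : Type
  | index (i : Fin n) : Word n
  | value (x : ℝ) : Word n

/-- A word as it is chosen by a server that holds a vector `v`: either an index `i`, or the entry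
`v i` at an index `i`. No other number can be transmitted. -/
inductive Item (n : ℕ) : Type
  | index (i : Fin n) : Item n
  | entry (i : Fin n) : Item n

/-- The word received when a server holding the vector `v` sends an item. -/
def Item.deliver {n : ℕ} (v : Fin n → ℝ) : Item n → Word n
  | .index i => .index i
  | .entry i => .value (v i)

/-- The record, at the Central Processor (CP), of one round: the random choice made by the CP, the
message (a list of indices) it sent to each server, and the message it received from each server. -/
structure Round (s n : ℕ) (Coin : Type) where
  coin : Coin
  ask : Fin s → List (Fin n)
  answer : Fin s → List (Word n)

/-- A randomized protocol for a CP and `s` servers holding vectors indexed by `Fin n`.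

The CP knows the records of the previous rounds; in each round it makes a random choice, whose
distribution may depend on these records, and sends a message to every server.

A server never inspects its whole vector. It knows an approximation (a real number) of the sum of
the `k`-th powers of its entries, some independent random samples of indices, each with the entry
at the sampled index, and the list of the messages it received from the CP so far, the current one
last; the items which it sends back are a function of these. -/
structure Protocol (s n : ℕ) where
  /-- The type of the random choices of the CP. -/
  Coin : Type
  /-- The number of samples that each server draws. -/
  samples : ℕ
  /-- The distribution of the random choice of the CP in a round, given the previous rounds. -/
  toss : List (Round s n Coin) → PMF Coin
  /-- The messages of the CP in a round. -/
  ask : List (Round s n Coin) → Coin → Fin s → List (Fin n)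
  /-- The message of a server in a round. -/
  answer : Fin s → ℝ → (Fin samples → Fin n × ℝ) → List (List (Fin n)) → List (Item n)
  /-- The output of the CP after the last round. -/
  output : List (Round s n Coin) → ℝ

theorem sum_prod_tapes {s n : ℕ} (p : Fin s → PMF (Fin n)) (l : ℕ) :
    ∑ σ : Fin s → Fin l → Fin n, ∏ t, ∏ j, p t (σ t j) = 1 := by
  have h1 : ∀ t, ∑ i, p t i = 1 := fun t => by
    rw [← tsum_fintype (L := SummationFilter.unconditional _)]
    exact (p t).tsum_coe
  have h2 : ∀ t, ∑ τ : Fin l → Fin n, ∏ j, p t (τ j) = 1 := fun t => by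
    rw [← Fintype.prod_sum (fun (_ : Fin l) i => p t i)]
    simp [h1]
  rw [← Fintype.prod_sum (fun t (τ : Fin l → Fin n) => ∏ j, p t (τ j))]
  simp [h2]

/-- The joint law of the samples: each server `t` draws `l` samples with law `p t`, and all the
samples are independent. -/
def tapes {s n : ℕ} (p : Fin s → PMF (Fin n)) (l : ℕ) : PMF (Fin s → Fin l → Fin n) :=
  PMF.ofFintype (fun σ => ∏ t, ∏ j, p t (σ t j)) (sum_prod_tapes p l)

namespace Protocol

variable {s n : ℕ} (P : Protocol s n)

/-- The next round, given the vectors `a t`, the approximate power sums `est t`, the samples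
`σ t`, the records `h` of the previous rounds and the random choice `c` of the CP. -/
def step (a : Fin s → Fin n → ℝ) (est : Fin s → ℝ) (σ : Fin s → Fin P.samples → Fin n)
    (h : List (Round s n P.Coin)) (c : P.Coin) : Round s n P.Coin where
  coin := c
  ask := P.ask h c
  answer := fun t =>
    (P.answer t (est t) (fun j => (σ t j, a t (σ t j)))
      (h.map (fun r => r.ask t) ++ [P.ask h c t])).map (Item.deliver (a t))

/-- The law of the records of the first `r` rounds, given the samples of the servers. -/
def run (a : Fin s → Fin n → ℝ) (est : Fin s → ℝ) (σ : Fin s → Fin P.samples → Fin n) :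
    ℕ → PMF (List (Round s n P.Coin))
  | 0 => PMF.pure []
  | r + 1 => (run a est σ r).bind fun h => (P.toss h).map fun c => h ++ [P.step a est σ h c]

/-- The law of the records of the first `r` rounds, when server `t` draws samples with law `p t`. -/
def law (a : Fin s → Fin n → ℝ) (est : Fin s → ℝ) (p : Fin s → PMF (Fin n)) (r : ℕ) :
    PMF (List (Round s n P.Coin)) :=
  (tapes p P.samples).bind fun σ => P.run a est σ r

end Protocol

/-- The number of words communicated in the recorded rounds, in both directions. The CP is located
at the server `cp`, so what it exchanges with that server is not communicated. -/
def words {s n : ℕ} {Coin : Type} (cp : Fin s) (h : List (Round s n Coin)) : ℕ :=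
  (h.map fun r => ∑ t ∈ Finset.univ.erase cp, ((r.ask t).length + (r.answer t).length)).sum

/-- The frequency moment `∑ i, (∑ t, a t i) ^ k`. -/
def moment {s n : ℕ} (k : ℕ) (a : Fin s → Fin n → ℝ) : ℝ := ∑ i, (∑ t, a t i) ^ k

/-- The access which the servers have to their vectors: `est t` is `∑ i, (a t i) ^ k` up to
relative error `η`, and `p t` gives the index `i` the probability `(a t i) ^ k / ∑ j, (a t j) ^ k`
(`p t` is arbitrary if that sum vanishes). -/
structure IsAccess {s n : ℕ} (k : ℕ) (η : ℝ) (a : Fin s → Fin n → ℝ) (est : Fin s → ℝ)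
    (p : Fin s → PMF (Fin n)) : Prop where
  est_spec : ∀ t, |est t - ∑ i, a t i ^ k| ≤ η * ∑ i, a t i ^ k
  sample_spec : ∀ t i, (p t i).toReal * ∑ j, a t j ^ k = a t i ^ k

end FreqMoment

end

noncomputable section

namespace FreqMoment

/-! ### Finite product laws: marginals, variance, Chebyshev. -/

section FiniteSums

variable {X ι T : Type*} [Fintype X] [Fintype ι] [Fintype T]

/-! Expand the moment of order `k + 1` over tuples `u` of `k + 1` servers. By symmetry in the
coordinates, the product of the entries `a (u j) i` may be replaced by `a (u 0) i ^ (k + 1) * ratio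
k a u i` (`sum_pow_mul_ratio`), and AM-GM gives `ratio ≤ 1`. This suggests importance sampling:
choose `u 0` with probability proportional to its power sum, the other `k` servers uniformly, and
`i` by a sample of `u 0`. The draw `s ^ k * (∑ t, E t) * ratio` then has mean close to the moment
`A`, the bias coming only from the errors of `E`. It is at most `s ^ k * ∑ t, E t`, so its second
moment is at most `4 * s ^ k * A ^ 2`, and by Chebyshev order `s ^ k / (δ * ε ^ 2)` draws suffice
(`sum_draws_bad_le`).

The difficulty is to tell the CP the power sums, as only indices and entries may be sent. A server
sends one sampled entry `v` and an integer multiple of `η * v ^ (k + 1)`, written as a remainder mod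
`n` and a unary quotient. Indices of small probability are rarely sampled (`sum_sample_small_le`),
so with high probability the quotient is of order `s / (δ * ε)`, independently of `n`; truncating it
bounds the cost of every execution.

The samples used for the draws are distinct from those of the first round (`slots_injective`), so
the draws are independent given the power sums known to the CP (`sum_tapes_slot`). -/

theorem sum_prod_eq_one [DecidableEq T] {q : T → X → ℝ} (hq : ∀ τ, ∑ y, q τ y = 1) :
    ∑ σ : T → X, ∏ τ, q τ (σ τ) = 1 := by
  rw [← Fintype.prod_sum]
  simp [hq]

/-- The marginal of a product law at distinct coordinates is the product of the marginals. -/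
theorem sum_prod_comp_injective [DecidableEq T] [DecidableEq ι] [DecidableEq X]
    {q : T → X → ℝ} (hq : ∀ τ, ∑ y, q τ y = 1) {φ : ι → T} (hφ : Function.Injective φ)
    (F : (ι → X) → ℝ) :
    ∑ σ : T → X, (∏ τ, q τ (σ τ)) * F (fun l => σ (φ l)) =
      ∑ x : ι → X, (∏ l, q (φ l) (x l)) * F x := by
  -- Point masses suffice. The indicator factors over the coordinates `τ`; by injectivity each fibre
  -- of `φ` has at most one point, and a coordinate outside the range sums to 1.
  have key : ∀ x : ι → X,
      ∑ σ : T → X, (∏ τ, q τ (σ τ)) * (if (fun l => σ (φ l)) = x then 1 else 0) =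
        ∏ l, q (φ l) (x l) := by
    intro x
    have h1 : ∀ σ : T → X, (if (fun l => σ (φ l)) = x then (1 : ℝ) else 0) =
        ∏ τ, ∏ l with φ l = τ, (if σ τ = x l then 1 else 0) := by
      intro σ
      have h2 : ∀ τ, ∏ l with φ l = τ, (if σ τ = x l then (1 : ℝ) else 0) =
          ∏ l with φ l = τ, (if σ (φ l) = x l then (1 : ℝ) else 0) := fun τ =>
        Finset.prod_congr rfl fun l hl => by rw [(Finset.mem_filter.1 hl).2]
      rw [Finset.prod_congr rfl fun τ _ => h2 τ, Finset.prod_fiberwise, Finset.prod_ite_zero]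
      simp [funext_iff]
    have h3 : ∀ τ, ∑ y, q τ y * ∏ l with φ l = τ, (if y = x l then (1 : ℝ) else 0) =
        ∏ l with φ l = τ, q (φ l) (x l) := by
      intro τ
      by_cases h : ∃ l, φ l = τ
      · obtain ⟨l, rfl⟩ := h
        have h4 : (Finset.univ.filter fun l' => φ l' = φ l) = {l} := by
          ext l'
          simp [hφ.eq_iff]
        simp [h4]
      · push Not at h
        simp [h, hq]
    simp_rw [h1, ← Finset.prod_mul_distrib]
    rw [← Fintype.prod_sum
      (fun τ y => q τ y * ∏ l with φ l = τ, (if y = x l then (1 : ℝ) else 0))]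
    rw [Finset.prod_congr rfl fun τ _ => h3 τ, Finset.prod_fiberwise]
  simp_rw [← key, Finset.sum_mul]
  rw [Finset.sum_comm]
  refine Finset.sum_congr rfl fun σ _ => ?_
  simp_rw [mul_assoc]
  rw [← Finset.mul_sum]
  simp

theorem sum_prod_apply [DecidableEq T] [DecidableEq X]
    {q : T → X → ℝ} (hq : ∀ τ, ∑ y, q τ y = 1) (τ : T) (g : X → ℝ) :
    ∑ σ : T → X, (∏ τ, q τ (σ τ)) * g (σ τ) = ∑ y, q τ y * g y := by
  rw [sum_prod_comp_injective hq (φ := fun _ : Unit => τ) (fun _ _ _ => rfl) (fun x => g (x ()))]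
  exact Fintype.sum_equiv (Equiv.funUnique Unit X) _ _ fun x => by simp

/-- The variance of a sum of independent centred copies. -/
theorem sum_prod_mul_sum_sq {W d : X → ℝ} (hW : ∑ x, W x = 1) (hd : ∑ x, W x * d x = 0) (N : ℕ) :
    ∑ x : Fin N → X, (∏ l, W (x l)) * (∑ l, d (x l)) = 0 ∧
    ∑ x : Fin N → X, (∏ l, W (x l)) * (∑ l, d (x l)) ^ 2 = N * ∑ x, W x * d x ^ 2 := by
  induction N with
  | zero => simp
  | succ N ih =>
    have h1 : ∑ x : Fin N → X, ∏ l, W (x l) = 1 := sum_prod_eq_one fun _ => hW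
    have split : ∀ F : (Fin (N + 1) → X) → ℝ,
        ∑ x, F x = ∑ y, ∑ x : Fin N → X, F (Fin.cons y x) := fun F => by
      rw [← (Fin.consEquiv fun _ => X).sum_comp, Fintype.sum_prod_type]
      rfl
    constructor
    · rw [split]
      simp only [Fin.prod_univ_succ, Fin.sum_univ_succ, Fin.cons_zero, Fin.cons_succ]
      have h2 : ∀ y, ∑ x : Fin N → X, W y * (∏ l, W (x l)) * (d y + ∑ l, d (x l)) = W y * d y := by
        intro y
        calc _ = W y * d y * ∑ x : Fin N → X, (∏ l, W (x l)) +
              W y * ∑ x : Fin N → X, (∏ l, W (x l)) * ∑ l, d (x l) := by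
                rw [Finset.mul_sum, Finset.mul_sum, ← Finset.sum_add_distrib]
                exact Finset.sum_congr rfl fun x _ => by ring
          _ = _ := by rw [h1, ih.1]; ring
      simp_rw [h2]
      exact hd
    · rw [split]
      simp only [Fin.prod_univ_succ, Fin.sum_univ_succ, Fin.cons_zero, Fin.cons_succ]
      have h2 : ∀ y, ∑ x : Fin N → X, W y * (∏ l, W (x l)) * (d y + ∑ l, d (x l)) ^ 2 =
          W y * d y ^ 2 + W y * (N * ∑ x, W x * d x ^ 2) := by
        intro y
        calc _ = W y * d y ^ 2 * ∑ x : Fin N → X, (∏ l, W (x l)) +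
              2 * W y * d y * ∑ x : Fin N → X, (∏ l, W (x l)) * ∑ l, d (x l) +
              W y * ∑ x : Fin N → X, (∏ l, W (x l)) * (∑ l, d (x l)) ^ 2 := by
                rw [Finset.mul_sum, Finset.mul_sum, Finset.mul_sum, ← Finset.sum_add_distrib,
                  ← Finset.sum_add_distrib]
                exact Finset.sum_congr rfl fun x _ => by ring
          _ = _ := by rw [h1, ih.1, ih.2]; ring
      simp_rw [h2]
      rw [Finset.sum_add_distrib, ← Finset.sum_mul, hW]
      push_cast
      ring

/-- Chebyshev's inequality for the mean of independent copies. -/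
theorem sum_prod_mul_indicator_le {W Z : X → ℝ} (hW0 : ∀ x, 0 ≤ W x) (hW : ∑ x, W x = 1) {N : ℕ}
    (hN : 0 < N) {μ τ : ℝ} (hμ : ∑ x, W x * Z x = μ) (hτ : 0 < τ) (S : Set (Fin N → X))
    [DecidablePred (· ∈ S)] (hS : ∀ x ∈ S, τ ≤ |(∑ l, Z (x l)) / N - μ|) :
    ∑ x : Fin N → X, (∏ l, W (x l)) * (if x ∈ S then 1 else 0) ≤
      (∑ x, W x * Z x ^ 2) / (N * τ ^ 2) := by
  have hN' : (0 : ℝ) < N := by exact_mod_cast hN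
  have hd : ∑ x, W x * (Z x - μ) = 0 := by
    simp_rw [mul_sub]
    rw [Finset.sum_sub_distrib, hμ, ← Finset.sum_mul, hW]
    ring
  have hvar : ∑ x, W x * (Z x - μ) ^ 2 ≤ ∑ x, W x * Z x ^ 2 := by
    have : ∑ x, W x * (Z x - μ) ^ 2 = ∑ x, W x * Z x ^ 2 - μ ^ 2 := by
      calc _ = ∑ x, W x * Z x ^ 2 - 2 * μ * ∑ x, W x * Z x + μ ^ 2 * ∑ x, W x := by
            rw [Finset.mul_sum, Finset.mul_sum, ← Finset.sum_sub_distrib,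
              ← Finset.sum_add_distrib]
            exact Finset.sum_congr rfl fun x _ => by ring
        _ = _ := by rw [hμ, hW]; ring
    nlinarith [sq_nonneg μ]
  have hpt : ∀ x : Fin N → X, (if x ∈ S then (1 : ℝ) else 0) ≤
      (∑ l, (Z (x l) - μ)) ^ 2 / (N * τ) ^ 2 := by
    intro x
    split_ifs with hx
    · have h1 := hS x hx
      have h2 : ∑ l, (Z (x l) - μ) = N * ((∑ l, Z (x l)) / N - μ) := by
        rw [Finset.sum_sub_distrib]
        simp
        field_simp
      rw [h2, le_div_iff₀ (by positivity), one_mul]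
      refine (pow_le_pow_left₀ (by positivity) (mul_le_mul_of_nonneg_left h1 hN'.le) 2).trans_eq ?_
      rw [mul_pow, sq_abs, mul_pow]
    · positivity
  calc _ ≤ ∑ x : Fin N → X, (∏ l, W (x l)) * ((∑ l, (Z (x l) - μ)) ^ 2 / (N * τ) ^ 2) :=
        Finset.sum_le_sum fun x _ =>
          mul_le_mul_of_nonneg_left (hpt x) (Finset.prod_nonneg fun l _ => hW0 _)
    _ = (N * ∑ x, W x * (Z x - μ) ^ 2) / (N * τ) ^ 2 := by
        rw [← (sum_prod_mul_sum_sq hW hd N).2, Finset.sum_div]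
        exact Finset.sum_congr rfl fun x _ => by ring
    _ ≤ (N * ∑ x, W x * Z x ^ 2) / (N * τ) ^ 2 := by gcongr
    _ = _ := by field_simp

end FiniteSums

/-! ### The importance sampling estimator and its bias. -/

section Estimator

variable {s n : ℕ}

/-- The product of the entries at `i` of the servers `u j`, relative to the mean of their powers. -/
def ratio (k : ℕ) (a : Fin s → Fin n → ℝ) (u : Fin (k + 1) → Fin s) (i : Fin n) : ℝ :=
  (∏ j, a (u j) i) / ((∑ j, a (u j) i ^ (k + 1)) / (k + 1))

/-- AM-GM for the powers `x j ^ (k + 1)` with equal weights. It keeps the value of a draw bounded.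
-/
theorem prod_le_mean_pow {k : ℕ} {x : Fin (k + 1) → ℝ} (hx : ∀ j, 0 ≤ x j) :
    ∏ j, x j ≤ (∑ j, x j ^ (k + 1)) / (k + 1) := by
  have h := Real.geom_mean_le_arith_mean_weighted Finset.univ (fun _ => ((k + 1 : ℕ) : ℝ)⁻¹)
    (fun j => x j ^ (k + 1)) (fun _ _ => by positivity)
    (by simp; field_simp) (fun j _ => pow_nonneg (hx j) _)
  rw [Finset.prod_congr rfl fun j _ => Real.pow_rpow_inv_natCast (hx j) (Nat.succ_ne_zero k),
    ← Finset.mul_sum] at h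
  rw [div_eq_inv_mul]
  exact_mod_cast h

variable {k : ℕ} {a : Fin s → Fin n → ℝ} (ha : ∀ t i, 0 ≤ a t i)
include ha

theorem ratio_nonneg (u : Fin (k + 1) → Fin s) (i : Fin n) : 0 ≤ ratio k a u i :=
  div_nonneg (Finset.prod_nonneg fun j _ => ha _ _)
    (div_nonneg (Finset.sum_nonneg fun j _ => pow_nonneg (ha _ _) _) (by positivity))

theorem ratio_le_one (u : Fin (k + 1) → Fin s) (i : Fin n) : ratio k a u i ≤ 1 :=
  div_le_one_of_le₀ (prod_le_mean_pow fun j => ha _ _)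
    (div_nonneg (Finset.sum_nonneg fun j _ => pow_nonneg (ha _ _) _) (by positivity))

/-- `ratio` is symmetric in the coordinates of `u`, so in the sum the power at `u 0` can be averaged
over all `u j`. The average cancels the denominator of `ratio`, and the products that remain are the
expansion of the power. -/
theorem sum_pow_mul_ratio (i : Fin n) :
    ∑ u : Fin (k + 1) → Fin s, a (u 0) i ^ (k + 1) * ratio k a u i = (∑ t, a t i) ^ (k + 1) := by
  have hswap : ∀ j : Fin (k + 1),
      ∑ u : Fin (k + 1) → Fin s, a (u j) i ^ (k + 1) * ratio k a u i =
        ∑ u : Fin (k + 1) → Fin s, a (u 0) i ^ (k + 1) * ratio k a u i := by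
    intro j
    refine Fintype.sum_equiv ((Equiv.swap 0 j).arrowCongr (Equiv.refl _)) _ _ fun u => ?_
    have h1 : ratio k a (((Equiv.swap 0 j).arrowCongr (Equiv.refl _)) u) i = ratio k a u i := by
      unfold ratio
      congr 1
      · exact Equiv.prod_comp (Equiv.swap 0 j).symm (fun j => a (u j) i)
      · congr 1
        exact Equiv.sum_comp (Equiv.swap 0 j).symm (fun j => a (u j) i ^ (k + 1))
    rw [h1]
    simp [Equiv.arrowCongr]
  have hu : ∀ u : Fin (k + 1) → Fin s,
      (∑ j, a (u j) i ^ (k + 1)) * ratio k a u i = (k + 1) * ∏ j, a (u j) i := by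
    intro u
    unfold ratio
    -- If the denominator of `ratio` vanishes, so does the product of entries.
    by_cases h : ∑ j, a (u j) i ^ (k + 1) = 0
    · have h0 := (Finset.sum_eq_zero_iff_of_nonneg
        (fun j _ => pow_nonneg (ha (u j) i) (k + 1))).1 h 0 (Finset.mem_univ _)
      have h1 : ∏ j, a (u j) i = 0 :=
        Finset.prod_eq_zero (Finset.mem_univ 0) (pow_eq_zero_iff (Nat.succ_ne_zero k) |>.1 h0)
      rw [h, h1]
      simp
    · have : (k + 1 : ℝ) ≠ 0 := by positivity
      field_simp
  have h1 : (k + 1 : ℝ) * ∑ u : Fin (k + 1) → Fin s, a (u 0) i ^ (k + 1) * ratio k a u i =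
      (k + 1) * (∑ t, a t i) ^ (k + 1) := by
    calc _ = ∑ j : Fin (k + 1), ∑ u : Fin (k + 1) → Fin s,
          a (u j) i ^ (k + 1) * ratio k a u i := by
          rw [Finset.sum_congr rfl fun j _ => hswap j]
          simp
      _ = ∑ u : Fin (k + 1) → Fin s, (k + 1) * ∏ j, a (u j) i := by
          rw [Finset.sum_comm]
          refine Finset.sum_congr rfl fun u _ => ?_
          rw [← Finset.sum_mul, hu]
      _ = _ := by rw [← Finset.mul_sum, Fintype.sum_pow]
  exact mul_left_cancel₀ (by positivity) h1

-- Powers are superadditive on nonnegative numbers. This compares the normalisation of the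
-- importance weights with the moment.
theorem sum_sum_pow_le_moment :
    ∑ t, ∑ i, a t i ^ (k + 1) ≤ moment (k + 1) a := by
  rw [Finset.sum_comm]
  refine Finset.sum_le_sum fun i _ => ?_
  have h0 : 0 ≤ ∑ t, a t i := Finset.sum_nonneg fun t _ => ha t i
  calc ∑ t, a t i ^ (k + 1) ≤ ∑ t, (∑ t, a t i) ^ k * a t i := by
        refine Finset.sum_le_sum fun t _ => ?_
        rw [pow_succ]
        exact mul_le_mul_of_nonneg_right (pow_le_pow_left₀ (ha t i)
          (Finset.single_le_sum (fun t _ => ha t i) (Finset.mem_univ t)) k) (ha t i)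
    _ = (∑ t, a t i) ^ (k + 1) := by rw [← Finset.mul_sum, pow_succ]

/-- Importance sampling with approximate weights has a small bias. -/
theorem abs_sum_weight_mul_ratio_sub_moment_le {w : Fin s → Fin n → ℝ} {θ : ℝ}
    (hw : ∀ t i, |w t i - a t i ^ (k + 1)| ≤ θ * a t i ^ (k + 1)) :
    |∑ u : Fin (k + 1) → Fin s, ∑ i, w (u 0) i * ratio k a u i - moment (k + 1) a| ≤
      θ * moment (k + 1) a := by
  have hA : moment (k + 1) a =
      ∑ u : Fin (k + 1) → Fin s, ∑ i, a (u 0) i ^ (k + 1) * ratio k a u i := by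
    rw [Finset.sum_comm]
    exact Finset.sum_congr rfl fun i _ => (sum_pow_mul_ratio ha i).symm
  rw [hA, ← Finset.sum_sub_distrib, Finset.mul_sum]
  refine (Finset.abs_sum_le_sum_abs _ _).trans (Finset.sum_le_sum fun u _ => ?_)
  rw [← Finset.sum_sub_distrib, Finset.mul_sum]
  refine (Finset.abs_sum_le_sum_abs _ _).trans (Finset.sum_le_sum fun i _ => ?_)
  rw [← sub_mul, abs_mul, abs_of_nonneg (ratio_nonneg ha u i), ← mul_assoc]
  exact mul_le_mul_of_nonneg_right (hw _ _) (ratio_nonneg ha u i)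

end Estimator

/-! ### Finite laws and real weights. -/

section Weights

variable {X : Type*} [Fintype X]

open Classical in
/-- The law with the given weights if they are nonnegative and sum to one. -/
def pmfOfWeights (x₀ : X) (w : X → ℝ) : PMF X :=
  if h : ∑ x, ENNReal.ofReal (w x) = 1 then PMF.ofFintype (fun x => ENNReal.ofReal (w x)) h
  else PMF.pure x₀

theorem toReal_pmfOfWeights (x₀ : X) {w : X → ℝ} (hw : ∀ x, 0 ≤ w x) (h : ∑ x, w x = 1) (x : X) :
    (pmfOfWeights x₀ w x).toReal = w x := by
  have h1 : ∑ x, ENNReal.ofReal (w x) = 1 := by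
    rw [← ENNReal.ofReal_sum_of_nonneg fun x _ => hw x, h, ENNReal.ofReal_one]
  rw [pmfOfWeights, dif_pos h1, PMF.ofFintype_apply, ENNReal.toReal_ofReal (hw x)]

theorem sum_toReal_pmf (p : PMF X) : ∑ x, (p x).toReal = 1 := by
  rw [← ENNReal.toReal_sum fun x _ => p.apply_ne_top x, ← tsum_fintype (L := .unconditional _),
    p.tsum_coe, ENNReal.toReal_one]

end Weights

/-! ### Encoding a power sum by indices and one entry. -/

/-- What a server sends first: one sampled entry, and its approximate power sum as a multiple of
a fraction of the power of that entry; the quotient by `n` of the factor is sent in unary. -/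
def encode {n : ℕ} (K : ℕ) (η : ℝ) (Q : ℕ) (e : ℝ) (y : Fin n × ℝ) : List (Item n) :=
  .entry y.1 :: .index ⟨⌊e / (y.2 ^ K * η)⌋₊ % n, Nat.mod_lt _ y.1.pos⟩ ::
    List.replicate (min (⌊e / (y.2 ^ K * η)⌋₊ / n) Q) (.index y.1)

/-- The approximate power sum that the CP reads off from the first message of a server. -/
def decode {n : ℕ} (K : ℕ) (η : ℝ) : List (Word n) → ℝ
  | .value x :: .index w :: l => x ^ K * η * ((n * l.length + w : ℕ) : ℝ)
  | _ => 0

theorem length_encode_le {n : ℕ} (K : ℕ) (η : ℝ) (Q : ℕ) (e : ℝ) (y : Fin n × ℝ) :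
    (encode K η Q e y).length ≤ Q + 2 := by
  simp [encode]

theorem decode_encode {n K Q : ℕ} {η e : ℝ} {v : Fin n → ℝ} {i : Fin n}
    (hQ : ⌊e / (v i ^ K * η)⌋₊ / n ≤ Q) :
    decode K η ((encode K η Q e (i, v i)).map (Item.deliver v)) =
      v i ^ K * η * (⌊e / (v i ^ K * η)⌋₊ : ℝ) := by
  simp only [encode, List.map_cons, Item.deliver, decode, List.length_map, List.length_replicate]
  rw [min_eq_left hQ, Nat.div_add_mod]

/-- Rounding down to a multiple of `η * v i ^ K` loses at most `η * c`. The integer sent is at most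
`2 * ρ * n / η`, so its quotient by `n` is at most `Q` and is not truncated. -/
theorem abs_decode_encode_sub_le {n K Q : ℕ} {η e c ρ : ℝ} {v : Fin n → ℝ} {i : Fin n}
    (hη : 0 < η) (he : 0 ≤ e) (he2 : e ≤ 2 * c) (hv : 0 < v i ^ K) (hvc : v i ^ K ≤ c)
    (hρ : c ≤ ρ * n * v i ^ K) (hQ : 2 * ρ / η ≤ Q) :
    |decode K η ((encode K η Q e (i, v i)).map (Item.deliver v)) - e| ≤ η * c := by
  have hpos : 0 < v i ^ K * η := mul_pos hv hη
  have hn : (0 : ℝ) < n := by exact_mod_cast i.pos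
  have h0 : 0 ≤ e / (v i ^ K * η) := div_nonneg he hpos.le
  have h1 := Nat.floor_le h0
  have h2 := Nat.lt_floor_add_one (e / (v i ^ K * η))
  rw [le_div_iff₀ hpos] at h1
  rw [div_lt_iff₀ hpos] at h2
  rw [decode_encode]
  · rw [abs_le]
    constructor <;> nlinarith
  · refine Nat.div_le_of_le_mul (Nat.floor_le_of_le ?_)
    rw [div_le_iff₀ hpos]
    rw [div_le_iff₀ hη] at hQ
    push_cast
    have : 2 * ρ * (n * v i ^ K) ≤ Q * η * (n * v i ^ K) := by gcongr
    nlinarith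

/-! ### The protocol, its output and its cost. -/

section Scheme

variable {s n : ℕ}

/-- The number of earlier draws that chose the same first server as the draw `l`. -/
def rank {k N : ℕ} (c : Fin N → Fin (k + 1) → Fin s) (l : Fin N) : ℕ :=
  (Finset.univ.filter fun l' => l' < l ∧ c l' 0 = c l 0).card

/-- The number of draws for which the first server is `t`. -/
def load {k N : ℕ} (c : Fin N → Fin (k + 1) → Fin s) (t : Fin s) : ℕ :=
  (Finset.univ.filter fun l => c l 0 = t).card

/-- A server is asked for only `load` samples, so this guarantees that the sample of each draw is
among those sent. -/
theorem rank_lt_load {k N : ℕ} (c : Fin N → Fin (k + 1) → Fin s) (l : Fin N) :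
    rank c l < load c (c l 0) := by
  refine Finset.card_lt_card ((Finset.ssubset_iff_of_subset fun x hx => ?_).2 ⟨l, ?_, ?_⟩)
  · simp only [Finset.mem_filter, Finset.mem_univ, true_and] at hx ⊢
    exact hx.2
  · simp
  · simp

theorem load_le {k N : ℕ} (c : Fin N → Fin (k + 1) → Fin s) (t : Fin s) : load c t ≤ N :=
  (Finset.card_le_univ _).trans (by simp)

theorem rank_lt {k N : ℕ} (c : Fin N → Fin (k + 1) → Fin s) (l : Fin N) : rank c l < N :=
  (rank_lt_load c l).trans_le (load_le c _)

theorem rank_lt_rank {k N : ℕ} {c : Fin N → Fin (k + 1) → Fin s} {l l' : Fin N} (h : l < l')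
    (hc : c l 0 = c l' 0) : rank c l < rank c l' := by
  refine Finset.card_lt_card ((Finset.ssubset_iff_of_subset fun x hx => ?_).2 ⟨l, ?_, ?_⟩)
  · simp only [Finset.mem_filter, Finset.mem_univ, true_and] at hx ⊢
    exact ⟨hx.1.trans h, hx.2.trans hc⟩
  · simp [h, hc]
  · simp

/-- The sample of its first server which a draw uses. -/
def slot {k N : ℕ} (c : Fin N → Fin (k + 1) → Fin s) (l : Fin N) : Fin s × Fin (N + 1) :=
  (c l 0, Fin.succ ⟨rank c l, rank_lt c l⟩)

/-- The samples that a run uses: the first one of each server, and one for each draw. -/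
def slots {k N : ℕ} (c : Fin N → Fin (k + 1) → Fin s) : Fin s ⊕ Fin N → Fin s × Fin (N + 1) :=
  Sum.elim (fun t => (t, 0)) (slot c)

/-- No sample is used twice: draws with the same first server differ in rank, and `Fin.succ` keeps
sample `0` for the first round. Independence rests on this. -/
theorem slots_injective {k N : ℕ} (c : Fin N → Fin (k + 1) → Fin s) :
    Function.Injective (slots c) := by
  refine Function.Injective.sumElim (fun t t' h => (Prod.ext_iff.1 h).1) (fun l l' h => ?_)
    fun t l h => ?_
  · have h0 : c l 0 = c l' 0 := (Prod.ext_iff.1 h).1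
    have h1 : rank c l = rank c l' := by
      have h2 : (slot c l).2 = (slot c l').2 := congrArg Prod.snd h
      simp only [slot] at h2
      exact congrArg Fin.val (Fin.succ_injective _ h2)
    rcases lt_trichotomy l l' with hl | hl | hl
    · exact absurd (rank_lt_rank hl h0) h1.not_lt
    · exact hl
    · exact absurd (rank_lt_rank hl h0.symm) h1.symm.not_lt
  · have h2 : (0 : Fin (N + 1)) = (slot c l).2 := congrArg Prod.snd h
    simp only [slot] at h2
    exact (Fin.succ_ne_zero _).symm h2

/-- The weight of a draw: a server chosen according to `E`, and `k` servers chosen uniformly. -/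
def drawWeight (k : ℕ) (E : Fin s → ℝ) (u : Fin (k + 1) → Fin s) : ℝ :=
  E (u 0) / (∑ t, E t) * (1 / (s : ℝ)) ^ k

theorem sum_drawWeight (hs : 0 < s) (k : ℕ) {E : Fin s → ℝ} (hE : ∑ t, E t ≠ 0) :
    ∑ u, drawWeight k E u = 1 := by
  have hs' : (s : ℝ) ≠ 0 := by exact_mod_cast hs.ne'
  rw [← (Fin.consEquiv fun _ => Fin s).sum_comp, Fintype.sum_prod_type]
  simp only [drawWeight, Fin.consEquiv, Equiv.coe_fn_mk, Fin.cons_zero, Finset.sum_const,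
    Finset.card_univ, Fintype.card_pi, Fintype.card_fin, Finset.prod_const, nsmul_eq_mul]
  rw [← Finset.mul_sum, ← Finset.sum_mul, ← Finset.sum_div, div_self hE]
  push_cast
  rw [one_mul, ← mul_pow, mul_one_div_cancel hs', one_pow]

/-- The value at the index `i` found in the answer `w` to the question `q`. -/
def lookup (q : List (Fin n)) (w : List (Word n)) (i : Fin n) : ℝ :=
  match w[q.idxOf i]? with
  | some (.value x) => x
  | _ => 0

/-- Repetitions in `q` are harmless, since all occurrences of an index carry the same entry. -/
theorem lookup_map_entry {q : List (Fin n)} {i : Fin n} (v : Fin n → ℝ) (hi : i ∈ q) :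
    lookup q ((q.map Item.entry).map (Item.deliver v)) i = v i := by
  simp [lookup, List.getElem?_map, List.getElem?_idxOf hi, Item.deliver]

variable (k N Q : ℕ) (η : ℝ) (cp : Fin s) (i₀ : Fin n)

/-- The random choice in a run: for each draw, `k + 1` servers. -/
abbrev Draws (s k N : ℕ) : Type := Fin N → Fin (k + 1) → Fin s

variable {k N} in
/-- The index sampled for the draw `l`, as recorded in the second round. -/
def drawn (r : Round s n (Draws s k N)) (l : Fin N) : Fin n :=
  match (r.answer (r.coin l 0))[rank r.coin l]? with
  | some (.index i) => i
  | _ => i₀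

/-- Importance sampling of the terms of the moment, expanded into products of `k + 1` entries. -/
def sampler : Protocol s n where
  Coin := Draws s k N
  samples := N + 1
  toss
    | [r] => pmfOfWeights (fun _ _ => cp)
        fun c => ∏ l, drawWeight k (fun t => decode (k + 1) η (r.answer t)) (c l)
    | _ => PMF.pure fun _ _ => cp
  ask
    | [], _, _ => []
    | [_], c, t => List.replicate (load c t) i₀
    | _ :: r :: _, _, t =>
        (Finset.univ.filter fun x : Fin N × Fin (k + 1) => r.coin x.1 x.2 = t).toList.map
          fun x => drawn i₀ r x.1
  answer := fun _ e y msgs => match msgs with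
    | [_] => encode (k + 1) η Q e (y 0)
    | [_, q] => ((List.finRange N).take q.length).map fun j => .index (y j.succ).1
    | [_, _, q] => q.map .entry
    | _ => []
  output
    | [r₀, r₁, r₂] =>
        (∑ l, (s : ℝ) ^ k * (∑ t, decode (k + 1) η (r₀.answer t)) *
          ((∏ j, lookup (r₂.ask (r₁.coin l j)) (r₂.answer (r₁.coin l j)) (drawn i₀ r₁ l)) /
            ((∑ j, lookup (r₂.ask (r₁.coin l j)) (r₂.answer (r₁.coin l j)) (drawn i₀ r₁ l) ^
              (k + 1)) / (k + 1)))) / N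
    | _ => 0

variable (a : Fin s → Fin n → ℝ) (est : Fin s → ℝ)

/-- The power sum of the server `t` as known to the CP, if its first sample is `i`. -/
def known (t : Fin s) (i : Fin n) : ℝ :=
  decode (k + 1) η ((encode (k + 1) η Q (est t) (i, a t i)).map (Item.deliver (a t)))

/-- The value of one draw. -/
def drawValue (E : Fin s → ℝ) (z : (Fin (k + 1) → Fin s) × Fin n) : ℝ :=
  (s : ℝ) ^ k * (∑ t, E t) * ratio k a z.1 z.2

/-- The records of a run in which the CP tosses `c` in the second round. -/
def transcript (σ : Fin s → Fin (N + 1) → Fin n) (c : Draws s k N) :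
    List (Round s n (Draws s k N)) :=
  let P := sampler k N Q η cp i₀
  let r₀ : Round s n (Draws s k N) := P.step a est σ [] fun _ _ => cp
  let r₁ : Round s n (Draws s k N) := P.step a est σ [r₀] c
  [r₀, r₁, P.step a est σ [r₀, r₁] fun _ _ => cp]

/-- The tosses of the first and third rounds are deterministic. The law of the second depends on `σ`
only through the first sample of each server. -/
theorem run_sampler (σ : Fin s → Fin (N + 1) → Fin n) :
    (sampler k N Q η cp i₀).run a est σ 3 =
      (pmfOfWeights (fun _ _ => cp)
        fun c => ∏ l, drawWeight k (fun t => known k Q η a est t (σ t 0)) (c l)).map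
        (transcript k N Q η cp i₀ a est σ) := by
  simp only [Protocol.run, PMF.pure_bind]
  simp only [PMF.map, PMF.bind_bind, Function.comp_def, PMF.pure_bind, List.nil_append]
  refine (PMF.pure_bind (α := Draws s k N) _ _).trans ?_
  refine congrArg (PMF.bind (α := Draws s k N) _) (funext fun c => ?_)
  exact PMF.pure_bind (α := Draws s k N) _ _

variable {k N Q η cp i₀ a est} in
theorem drawn_transcript (σ : Fin s → Fin (N + 1) → Fin n) (c : Draws s k N)
    (h : List (Round s n (Draws s k N))) (r : Round s n (Draws s k N)) (hr : h = [r]) (l : Fin N) :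
    drawn i₀ ((sampler k N Q η cp i₀).step a est σ h c) l = σ (slot c l).1 (slot c l).2 := by
  subst hr
  have h1 : ((sampler k N Q η cp i₀).step a est σ [r] c).answer (c l 0) =
      (((List.finRange N).take (load c (c l 0))).map fun j =>
        Item.index (σ (c l 0) j.succ)).map (Item.deliver (a (c l 0))) := by
    simp [Protocol.step, sampler]
  have h2 : rank c l < load c (c l 0) := rank_lt_load c l
  change (match (((sampler k N Q η cp i₀).step a est σ [r] c).answer (c l 0))[rank c l]? with
    | some (.index i) => i
    | _ => i₀) = _
  rw [h1]
  simp [h2, rank_lt c l, Item.deliver, slot]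

theorem output_transcript (σ : Fin s → Fin (N + 1) → Fin n) (c : Draws s k N) :
    (sampler k N Q η cp i₀).output (transcript k N Q η cp i₀ a est σ c) =
      (∑ l, drawValue k a (fun t => known k Q η a est t (σ t 0))
        (c l, σ (slot c l).1 (slot c l).2)) / N := by
  set P := sampler k N Q η cp i₀ with hP
  set r₀ : Round s n (Draws s k N) := P.step a est σ [] fun _ _ => cp with hr₀
  set r₁ : Round s n (Draws s k N) := P.step a est σ [r₀] c with hr₁
  set r₂ : Round s n (Draws s k N) := P.step a est σ [r₀, r₁] fun _ _ => cp with hr₂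
  have hd : ∀ l, drawn i₀ r₁ l = σ (slot c l).1 (slot c l).2 := fun l =>
    drawn_transcript σ c [r₀] r₀ rfl l
  have hl : ∀ l j, lookup (r₂.ask (c l j)) (r₂.answer (c l j)) (drawn i₀ r₁ l) =
      a (c l j) (σ (slot c l).1 (slot c l).2) := by
    intro l j
    have h1 : r₂.answer (c l j) =
        ((r₂.ask (c l j)).map Item.entry).map (Item.deliver (a (c l j))) := rfl
    rw [h1, lookup_map_entry, hd]
    -- The pair `(l, j)` itself puts this index into the question to the server `c l j`.
    refine List.mem_map.2 ⟨(l, j), ?_, rfl⟩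
    simp only [Finset.mem_toList, Finset.mem_filter, Finset.mem_univ, true_and]
    rfl
  change (∑ l, (s : ℝ) ^ k * (∑ t, known k Q η a est t (σ t 0)) *
    ((∏ j, lookup (r₂.ask (c l j)) (r₂.answer (c l j)) (drawn i₀ r₁ l)) /
      ((∑ j, lookup (r₂.ask (c l j)) (r₂.answer (c l j)) (drawn i₀ r₁ l) ^ (k + 1)) /
        (k + 1)))) / N = _
  simp only [hl]
  rfl

/-- One term per round: unary messages capped by `Q`; loads, which add up to `N`, in both
directions; and one question and one entry for each draw and coordinate. -/
theorem words_transcript_le (σ : Fin s → Fin (N + 1) → Fin n) (c : Draws s k N) :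
    words cp (transcript k N Q η cp i₀ a est σ c) ≤ s * (Q + 2) + 2 * N + 2 * (N * (k + 1)) := by
  set P := sampler k N Q η cp i₀ with hP
  set r₀ : Round s n (Draws s k N) := P.step a est σ [] fun _ _ => cp with hr₀
  set r₁ : Round s n (Draws s k N) := P.step a est σ [r₀] c with hr₁
  set r₂ : Round s n (Draws s k N) := P.step a est σ [r₀, r₁] fun _ _ => cp with hr₂
  have sum_le : ∀ (r : Round s n (Draws s k N)) (b : Fin s → ℕ),
      (∀ t, (r.ask t).length + (r.answer t).length ≤ b t) →
      ∑ t ∈ Finset.univ.erase cp, ((r.ask t).length + (r.answer t).length) ≤ ∑ t, b t :=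
    fun r b h => (Finset.sum_le_sum fun t _ => h t).trans
      (Finset.sum_le_sum_of_subset (Finset.subset_univ _))
  have h0 := sum_le r₀ (fun _ => Q + 2) fun t => by
    have h1 : (r₀.ask t).length = 0 := rfl
    have h2 : r₀.answer t = (encode (k + 1) η Q (est t) (σ t 0, a t (σ t 0))).map
      (Item.deliver (a t)) := rfl
    rw [h1, h2, List.length_map, zero_add]
    exact length_encode_le ..
  have h1 := sum_le r₁ (fun t => 2 * load c t) fun t => by
    have h1 : r₁.ask t = List.replicate (load c t) i₀ := rfl
    have h2 : r₁.answer t = (((List.finRange N).take (r₁.ask t).length).map fun j =>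
        Item.index (σ t j.succ)).map (Item.deliver (a t)) := rfl
    rw [h2, h1]
    simp only [List.length_replicate, List.length_map, List.length_take, List.length_finRange]
    omega
  have h2 := sum_le r₂ (fun t =>
      2 * (Finset.univ.filter fun x : Fin N × Fin (k + 1) => c x.1 x.2 = t).card) fun t => by
    have h1 : r₂.ask t = ((Finset.univ.filter fun x : Fin N × Fin (k + 1) =>
      c x.1 x.2 = t).toList.map fun x => drawn i₀ r₁ x.1) := rfl
    have h2 : r₂.answer t = ((r₂.ask t).map Item.entry).map (Item.deliver (a t)) := rfl
    rw [h2, h1]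
    simp only [List.length_map, Finset.length_toList]
    omega
  have h3 : ∑ t, load c t = N := by
    rw [show (∑ t, load c t) = (Finset.univ : Finset (Fin N)).card from
      (Finset.card_eq_sum_card_fiberwise fun _ _ => Finset.mem_univ _).symm]
    simp
  have h4 : ∑ t, (Finset.univ.filter fun x : Fin N × Fin (k + 1) => c x.1 x.2 = t).card =
      N * (k + 1) := by
    rw [← Finset.card_eq_sum_card_fiberwise fun _ _ => Finset.mem_univ _]
    simp
  rw [← Finset.mul_sum, h3] at h1
  rw [← Finset.mul_sum, h4] at h2
  rw [Finset.sum_const, Finset.card_univ, Fintype.card_fin, smul_eq_mul] at h0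
  have h5 : words cp (transcript k N Q η cp i₀ a est σ c) =
      ∑ t ∈ Finset.univ.erase cp, ((r₀.ask t).length + (r₀.answer t).length) +
      (∑ t ∈ Finset.univ.erase cp, ((r₁.ask t).length + (r₁.answer t).length) +
      (∑ t ∈ Finset.univ.erase cp, ((r₂.ask t).length + (r₂.answer t).length) + 0)) := rfl
  omega

end Scheme

/-! ### From laws of executions to finite sums. -/

open Classical in
theorem toReal_toOuterMeasure_pmf {X : Type*} [Fintype X] (p : PMF X) (S : Set X) :
    (p.toOuterMeasure S).toReal = 1 - ∑ x, (p x).toReal * (if x ∈ S then 0 else 1) := by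
  rw [PMF.toOuterMeasure_apply_fintype, ENNReal.toReal_sum, eq_sub_iff_add_eq,
    ← Finset.sum_add_distrib]
  · refine Eq.trans ?_ (sum_toReal_pmf p)
    refine Finset.sum_congr rfl fun x _ => ?_
    by_cases h : x ∈ S <;> simp [h]
  · intro x _
    by_cases h : x ∈ S <;> simp [h, p.apply_ne_top]

variable {s n : ℕ}

theorem toReal_tapes (p : Fin s → PMF (Fin n)) (L : ℕ) (σ : Fin s → Fin L → Fin n) :
    (tapes p L σ).toReal = ∏ t, ∏ j, (p t (σ t j)).toReal := by
  simp [tapes, ENNReal.toReal_prod]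

/-- The slots depend on the toss `c`. With the sum over `c` taken outside they are fixed and
distinct, so their samples have a product law, even though the weight of `c` depends on the first
samples. -/
theorem sum_tapes_slot {k N : ℕ} {q : Fin s → Fin n → ℝ} (hq : ∀ t, ∑ i, q t i = 1)
    (F : (Fin s → Fin n) → Draws s k N → (Fin N → Fin n) → ℝ) :
    ∑ σ : Fin s → Fin (N + 1) → Fin n, (∏ t, ∏ j, q t (σ t j)) *
        ∑ c, F (fun t => σ t 0) c (fun l => σ (slot c l).1 (slot c l).2) =
      ∑ y : Fin s → Fin n, (∏ t, q t (y t)) *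
        ∑ c : Draws s k N, ∑ x : Fin N → Fin n, (∏ l, q (c l 0) (x l)) * F y c x := by
  simp_rw [Finset.mul_sum]
  rw [Finset.sum_comm]
  conv_rhs => rw [Finset.sum_comm]
  refine Finset.sum_congr rfl fun c _ => ?_
  rw [← (Equiv.curry (Fin s) (Fin (N + 1)) (Fin n)).sum_comp]
  have h := sum_prod_comp_injective (q := fun τ : Fin s × Fin (N + 1) => q τ.1) (fun τ => hq τ.1)
    (slots_injective c) (fun x => F (fun t => x (.inl t)) c (fun l => x (.inr l)))
  rw [Fintype.sum_congr _ _ fun σ : Fin s × Fin (N + 1) → Fin n => by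
    rw [Fintype.prod_prod_type]] at h
  refine h.trans ?_
  rw [← (Equiv.sumArrowEquivProdArrow (Fin s) (Fin N) (Fin n)).symm.sum_comp,
    Fintype.sum_prod_type]
  refine Finset.sum_congr rfl fun y _ => Finset.sum_congr rfl fun x _ => ?_
  rw [Fintype.prod_sum_type, ← mul_assoc]
  rfl

/-! ### Probability of success. -/

section Access

variable {k Q : ℕ} {ε δ : ℝ} {a : Fin s → Fin n → ℝ} {est : Fin s → ℝ} {p : Fin s → PMF (Fin n)}

/-- Error budget: `ε / 2` from the server's own approximation and `ε / 4` from rounding, which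
leaves `ε / 4` for sampling. -/
theorem abs_known_sub_le (ha : ∀ t i, 0 ≤ a t i) (hε : 0 < ε) (hε1 : ε < 1)
    (hacc : IsAccess (k + 1) (ε / 2) a est p) {ρ : ℝ} (hQ : 2 * ρ / (ε / 4) ≤ Q) {t : Fin s}
    {i : Fin n} (hi : ∑ j, a t j ^ (k + 1) ≤ ρ * n * a t i ^ (k + 1)) :
    |known k Q (ε / 4) a est t i - ∑ j, a t j ^ (k + 1)| ≤
      3 / 4 * ε * ∑ j, a t j ^ (k + 1) := by
  have hest := hacc.est_spec t
  set c := ∑ j, a t j ^ (k + 1) with hc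
  have hv : ∀ j, 0 ≤ a t j ^ (k + 1) := fun j => pow_nonneg (ha t j) _
  have hvc : a t i ^ (k + 1) ≤ c := Finset.single_le_sum (fun j _ => hv j) (Finset.mem_univ i)
  -- A vanishing entry satisfies `hi` only if the whole power sum vanishes; division by zero then
  -- makes the decoded value 0, which is correct.
  rcases (hv i).eq_or_lt with h0 | h0
  · have hc0 : c = 0 := le_antisymm (by rw [← h0] at hi; simpa using hi) ((hv i).trans hvc)
    rw [hc0] at hest ⊢
    have hk : known k Q (ε / 4) a est t i = 0 := by
      unfold known
      rw [decode_encode] <;> simp [← h0]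
    simp [hk]
  · have h1 := abs_le.1 hest
    have h2 : |known k Q (ε / 4) a est t i - est t| ≤ ε / 4 * c :=
      abs_decode_encode_sub_le (by positivity) (by nlinarith) (by nlinarith) h0 hvc hi hQ
    have h3 := abs_le.1 h2
    rw [abs_le]
    constructor <;> linarith

/-- A sample is rarely an index with a small entry. -/
theorem sum_sample_small_le (ha : ∀ t i, 0 ≤ a t i) {η ρ : ℝ} (hacc : IsAccess (k + 1) η a est p)
    (hρ : 0 < ρ) (t : Fin s) :
    ∑ i, (p t i).toReal * (if ∑ j, a t j ^ (k + 1) ≤ ρ * n * a t i ^ (k + 1) then 0 else 1) ≤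
      1 / ρ := by
  set c := ∑ j, a t j ^ (k + 1) with hc
  have hv : ∀ j, 0 ≤ a t j ^ (k + 1) := fun j => pow_nonneg (ha t j) _
  have hp := hacc.sample_spec t
  -- Each small index has probability at most `1 / (ρ * n)`, and there are at most `n` of them.
  have hpt : ∀ i, (p t i).toReal * (if c ≤ ρ * n * a t i ^ (k + 1) then 0 else 1) ≤
      1 / (ρ * n) := by
    intro i
    have hn : (0 : ℝ) < n := by exact_mod_cast i.pos
    split_ifs with h
    · rw [mul_zero]
      positivity
    · push Not at h
      rw [← hp i] at h
      have hc0 : 0 < c := lt_of_le_of_lt (by rw [hp i]; have := hv i; positivity) h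
      rw [mul_one, le_div_iff₀ (by positivity)]
      by_contra! h1
      nlinarith
  refine (Finset.sum_le_sum fun i _ => hpt i).trans ?_
  rcases Nat.eq_zero_or_pos n with rfl | hn
  · simp; positivity
  · have hn : (0 : ℝ) < n := by exact_mod_cast hn
    simp only [Finset.sum_const, Finset.card_univ, Fintype.card_fin, nsmul_eq_mul]
    apply le_of_eq
    field_simp

open Classical in
/-- If the CP knows the power sums approximately, then the mean of the draws is rarely wrong. -/
theorem sum_draws_bad_le (ha : ∀ t i, 0 ≤ a t i) (hε : 0 < ε) (hε1 : ε < 1) {η : ℝ}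
    (hacc : IsAccess (k + 1) η a est p) {N : ℕ} (hN0 : 0 < N)
    (hN : 128 * (s : ℝ) ^ k ≤ N * δ * ε ^ 2) (hδ : 0 ≤ δ) (cp : Fin s) {E : Fin s → ℝ}
    (hE : ∀ t, |E t - ∑ j, a t j ^ (k + 1)| ≤ 3 / 4 * ε * ∑ j, a t j ^ (k + 1)) :
    ∑ c : Draws s k N, ∑ x : Fin N → Fin n, (∏ l, (p (c l 0) (x l)).toReal) *
      ((pmfOfWeights (fun _ _ => cp) (fun c : Draws s k N => ∏ l, drawWeight k E (c l)) c).toReal *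
        (if |(∑ l, drawValue k a E (c l, x l)) / N - moment (k + 1) a| ≤
          ε * moment (k + 1) a then 0 else 1)) ≤ δ / 2 := by
  set A := moment (k + 1) a with hA
  have hC0 : ∀ t, 0 ≤ ∑ j, a t j ^ (k + 1) := fun t =>
    Finset.sum_nonneg fun j _ => pow_nonneg (ha t j) _
  set C : Fin s → ℝ := fun t => ∑ j, a t j ^ (k + 1) with hC
  change ∀ t, 0 ≤ C t at hC0
  change ∀ t, |E t - C t| ≤ 3 / 4 * ε * C t at hE
  have hBA : ∑ t, C t ≤ A := sum_sum_pow_le_moment ha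
  have hE0 : ∀ t, 0 ≤ E t := fun t => by
    have := abs_le.1 (hE t)
    nlinarith [hC0 t]
  have hE2 : ∑ t, E t ≤ 2 * ∑ t, C t := by
    rw [Finset.mul_sum]
    refine Finset.sum_le_sum fun t _ => ?_
    have := abs_le.1 (hE t)
    nlinarith [hC0 t]
  have hE1 : (1 - 3 / 4 * ε) * ∑ t, C t ≤ ∑ t, E t := by
    rw [Finset.mul_sum]
    refine Finset.sum_le_sum fun t _ => ?_
    have := abs_le.1 (hE t)
    nlinarith [hC0 t]
  rcases (Finset.sum_nonneg fun t _ => hC0 t : 0 ≤ ∑ t, C t).eq_or_lt with hB | hB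
  -- Here the weights do not sum to one and the toss takes its default value, but every draw has
  -- value 0, which is the moment.
  · have ha0 : ∀ t i, a t i = 0 := fun t i => by
      have h1 := (Finset.sum_eq_zero_iff_of_nonneg fun t _ => hC0 t).1 hB.symm t (Finset.mem_univ _)
      have h2 := (Finset.sum_eq_zero_iff_of_nonneg
        fun j _ => pow_nonneg (ha t j) _).1 h1 i (Finset.mem_univ _)
      exact pow_eq_zero_iff (Nat.succ_ne_zero k) |>.1 h2
    have hEs : ∑ t, E t = 0 :=
      le_antisymm (by rw [← hB] at hE2; simpa using hE2) (Finset.sum_nonneg fun t _ => hE0 t)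
    have hA0 : A = 0 := by simp [hA, moment, ha0]
    simp only [drawValue, hEs, hA0]
    simp
    positivity
  · have hs : 0 < s := cp.pos
    have hs' : (0 : ℝ) < s := by exact_mod_cast hs
    have hA0 : 0 < A := hB.trans_le hBA
    have hEs : 0 < ∑ t, E t := lt_of_lt_of_le (mul_pos (by linarith) hB) hE1
    have hq : ∀ t, ∑ i, (p t i).toReal = 1 := fun t => sum_toReal_pmf (p t)
    have hdw : ∀ u, 0 ≤ drawWeight k E u := fun u =>
      mul_nonneg (div_nonneg (hE0 _) hEs.le) (by positivity)
    have hdw1 : ∑ u, drawWeight k E u = 1 := sum_drawWeight hs k hEs.ne'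
    set W : (Fin (k + 1) → Fin s) × Fin n → ℝ :=
      fun z => drawWeight k E z.1 * (p (z.1 0) z.2).toReal with hW
    have hW0 : ∀ z, 0 ≤ W z := fun z => mul_nonneg (hdw _) ENNReal.toReal_nonneg
    have hW1 : ∑ z, W z = 1 := by
      rw [Fintype.sum_prod_type, ← hdw1]
      refine Finset.sum_congr rfl fun u _ => ?_
      simp only [hW]
      rw [← Finset.mul_sum, hq, mul_one]
    set Z := drawValue k a E with hZ
    have hZ0 : ∀ z, 0 ≤ Z z := fun z =>
      mul_nonneg (mul_nonneg (by positivity) hEs.le) (ratio_nonneg ha _ _)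
    have hZ1 : ∀ z, Z z ≤ (s : ℝ) ^ k * ∑ t, E t := fun z =>
      mul_le_of_le_one_right (mul_nonneg (by positivity) hEs.le) (ratio_le_one ha _ _)
    -- The factors `s ^ k` and `∑ t, E t` of a draw cancel the normalisations in its weight.
    have hWZ : ∑ z, W z * Z z =
        ∑ u : Fin (k + 1) → Fin s, ∑ i, (E (u 0) * (p (u 0) i).toReal) * ratio k a u i := by
      rw [Fintype.sum_prod_type]
      refine Finset.sum_congr rfl fun u _ => Finset.sum_congr rfl fun i _ => ?_
      simp only [hW, hZ, drawValue, drawWeight]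
      have h1 : (s : ℝ) ^ k * (1 / (s : ℝ)) ^ k = 1 := by
        rw [← mul_pow, mul_one_div_cancel hs'.ne', one_pow]
      have h2 : E (u 0) / (∑ t, E t) * ∑ t, E t = E (u 0) := div_mul_cancel₀ _ hEs.ne'
      calc _ = (E (u 0) / (∑ t, E t) * ∑ t, E t) * ((s : ℝ) ^ k * (1 / (s : ℝ)) ^ k) *
            ((p (u 0) i).toReal * ratio k a u i) := by ring
        _ = _ := by rw [h1, h2]; ring
    have hμ : |∑ z, W z * Z z - A| ≤ 3 / 4 * ε * A := by
      rw [hWZ]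
      refine abs_sum_weight_mul_ratio_sub_moment_le (k := k) ha
        (w := fun t i => E t * (p t i).toReal) fun t i => ?_
      have h1 := hacc.sample_spec t i
      have h2 : E t * (p t i).toReal - a t i ^ (k + 1) = (E t - C t) * (p t i).toReal := by
        rw [← h1]; ring
      rw [h2, abs_mul, abs_of_nonneg (ENNReal.toReal_nonneg : 0 ≤ (p t i).toReal), ← h1]
      calc _ ≤ 3 / 4 * ε * C t * (p t i).toReal :=
            mul_le_mul_of_nonneg_right (hE t) ENNReal.toReal_nonneg
        _ = _ := by ring
    -- The second moment is at most the maximum times the mean, where the mean and `∑ t, E t` are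
    -- both at most `2 * A`.
    have hZsq : ∑ z, W z * Z z ^ 2 ≤ 4 * (s : ℝ) ^ k * A ^ 2 := by
      have h1 : ∑ z, W z * Z z ≤ 2 * A := by
        have := abs_le.1 hμ
        nlinarith
      calc _ ≤ ∑ z, (s : ℝ) ^ k * (∑ t, E t) * (W z * Z z) := by
            refine Finset.sum_le_sum fun z _ => ?_
            have := mul_le_mul_of_nonneg_right (hZ1 z) (mul_nonneg (hW0 z) (hZ0 z))
            nlinarith
        _ = (s : ℝ) ^ k * ((∑ t, E t) * ∑ z, W z * Z z) := by rw [← Finset.mul_sum]; ring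
        _ ≤ (s : ℝ) ^ k * ((2 * A) * (2 * A)) := by
            have h2 : ∑ t, E t ≤ 2 * A := by linarith
            have h3 : 0 ≤ ∑ z, W z * Z z :=
              Finset.sum_nonneg fun z _ => mul_nonneg (hW0 z) (hZ0 z)
            gcongr
        _ = _ := by ring
    have hV : ∀ c : Draws s k N,
        (pmfOfWeights (fun _ _ => cp) (fun c : Draws s k N => ∏ l, drawWeight k E (c l)) c).toReal =
          ∏ l, drawWeight k E (c l) :=
      toReal_pmfOfWeights _ (fun c => Finset.prod_nonneg fun l _ => hdw _)
        (sum_prod_eq_one fun _ => hdw1)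
    -- The bias uses up `3 / 4 * ε * A`, so a failure is a deviation of at least `ε * A / 4` from
    -- the mean.
    have hcheb := sum_prod_mul_indicator_le (Z := Z) hW0 hW1 hN0 rfl (τ := ε * A / 4) (by positivity)
      {x | ¬ |(∑ l, Z (x l)) / N - A| ≤ ε * A} (fun x hx => by
        have h1 : ε * A < |(∑ l, Z (x l)) / N - A| := not_le.1 hx
        have h2 := abs_sub_le ((∑ l, Z (x l)) / N) (∑ z, W z * Z z) A
        linarith)
    have hfinal : (∑ z, W z * Z z ^ 2) / (N * (ε * A / 4) ^ 2) ≤ δ / 2 := by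
      have hN' : (0 : ℝ) < N := by exact_mod_cast hN0
      rw [div_le_iff₀ (by positivity)]
      refine hZsq.trans ?_
      -- The 128 is `4 * 16 * 2`: second moment, squared deviation, and half of `δ`.
      nlinarith [mul_le_mul_of_nonneg_right hN (sq_nonneg A)]
    refine le_trans (le_of_eq ?_) (hcheb.trans hfinal)
    rw [← (Equiv.arrowProdEquivProdArrow (Fin N) (fun _ => Fin (k + 1) → Fin s)
      (fun _ => Fin n)).symm.sum_comp, Fintype.sum_prod_type]
    refine Finset.sum_congr rfl fun c _ => Finset.sum_congr rfl fun x _ => ?_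
    rw [hV, ← mul_assoc, ← Finset.prod_mul_distrib]
    congr 1
    · exact Finset.prod_congr rfl fun l _ => mul_comm _ _
    · simp only [Set.mem_ofPred_eq, ite_not]
      rfl

/-- The sampling protocol succeeds with probability at least `1 - δ`. -/
theorem le_law_sampler (ha : ∀ t i, 0 ≤ a t i) (hε : 0 < ε) (hε1 : ε < 1) (hδ : 0 < δ)
    (hacc : IsAccess (k + 1) (ε / 2) a est p) {N : ℕ} (hN0 : 0 < N)
    (hN : 128 * (s : ℝ) ^ k ≤ N * δ * ε ^ 2) (hQ : 16 * s / (δ * ε) ≤ Q) (cp : Fin s)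
    (i₀ : Fin n) :
    ENNReal.ofReal (1 - δ) ≤ ((sampler k N Q (ε / 4) cp i₀).law a est p 3).toOuterMeasure
      {h | |(sampler k N Q (ε / 4) cp i₀).output h - moment (k + 1) a| ≤
        ε * moment (k + 1) a} := by
  classical
  set A := moment (k + 1) a with hA
  set S : Set (List (Round s n (Draws s k N))) :=
    {h | |(sampler k N Q (ε / 4) cp i₀).output h - A| ≤ ε * A} with hS
  have hs' : (0 : ℝ) < s := by exact_mod_cast cp.pos
  set E : (Fin s → Fin n) → Fin s → ℝ := fun y t => known k Q (ε / 4) a est t (y t) with hE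
  set V : (Fin s → Fin n) → PMF (Draws s k N) := fun y =>
    pmfOfWeights (fun _ _ => cp) fun c => ∏ l, drawWeight k (E y) (c l) with hV
  set F : (Fin s → Fin n) → Draws s k N → (Fin N → Fin n) → ℝ := fun y c x => (V y c).toReal *
    (if |(∑ l, drawValue k a (E y) (c l, x l)) / N - A| ≤ ε * A then 0 else 1) with hF
  set q : Fin s → Fin n → ℝ := fun t i => (p t i).toReal with hq
  have hq0 : ∀ t i, 0 ≤ q t i := fun t i => ENNReal.toReal_nonneg
  have hq1 : ∀ t, ∑ i, q t i = 1 := fun t => sum_toReal_pmf (p t)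
  -- A union bound over `s` servers costs `s / ρ = δ / 2`, and `2 * ρ / (ε / 4)` is the bound
  -- required of `Q`.
  set ρ := 2 * s / δ with hρ
  set bad : (t : Fin s) → Fin n → ℝ := fun t i =>
    if ∑ j, a t j ^ (k + 1) ≤ ρ * n * a t i ^ (k + 1) then 0 else 1 with hbad
  have hbad0 : ∀ t i, 0 ≤ bad t i := fun t i => by
    simp only [hbad]
    split_ifs <;> norm_num
  have hfail : ∑ y : Fin s → Fin n, (∏ t, q t (y t)) *
      ∑ c : Draws s k N, ∑ x : Fin N → Fin n, (∏ l, q (c l 0) (x l)) * F y c x ≤ δ := by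
    -- If some first sample is bad, the right side is at least 1; otherwise the power sums are known
    -- well enough for Chebyshev.
    have hy : ∀ y : Fin s → Fin n,
        ∑ c : Draws s k N, ∑ x : Fin N → Fin n, (∏ l, q (c l 0) (x l)) * F y c x ≤
          ∑ t, bad t (y t) + δ / 2 := by
      intro y
      by_cases hgood : ∀ t, ∑ j, a t j ^ (k + 1) ≤ ρ * n * a t (y t) ^ (k + 1)
      · refine (sum_draws_bad_le ha hε hε1 hacc hN0 hN hδ.le cp fun t =>
          abs_known_sub_le ha hε hε1 hacc ?_ (hgood t)).trans ?_
        · refine le_trans (le_of_eq ?_) hQ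
          rw [hρ]
          field_simp
          norm_num
        · exact le_add_of_nonneg_left (Finset.sum_nonneg fun t _ => hbad0 _ _)
      · push Not at hgood
        obtain ⟨t, ht⟩ := hgood
        have h1 : 1 ≤ ∑ t, bad t (y t) := by
          have : bad t (y t) = 1 := if_neg ht.not_ge
          rw [← this]
          exact Finset.single_le_sum (f := fun t => bad t (y t)) (fun t _ => hbad0 _ _)
            (Finset.mem_univ t)
        have h2 : ∑ c : Draws s k N, ∑ x : Fin N → Fin n, (∏ l, q (c l 0) (x l)) * F y c x ≤
            ∑ c : Draws s k N, (V y c).toReal := by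
          refine Finset.sum_le_sum fun c _ => ?_
          calc _ ≤ ∑ x : Fin N → Fin n, (∏ l, q (c l 0) (x l)) * (V y c).toReal := by
                refine Finset.sum_le_sum fun x _ => mul_le_mul_of_nonneg_left ?_
                  (Finset.prod_nonneg fun l _ => hq0 _ _)
                refine mul_le_of_le_one_right ENNReal.toReal_nonneg ?_
                split_ifs <;> norm_num
            _ = _ := by
                rw [← Finset.sum_mul, sum_prod_eq_one (q := fun l => q (c l 0)) fun l => hq1 _,
                  one_mul]
        rw [sum_toReal_pmf] at h2
        linarith
    calc _ ≤ ∑ y : Fin s → Fin n, (∏ t, q t (y t)) * (∑ t, bad t (y t) + δ / 2) :=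
          Finset.sum_le_sum fun y _ => mul_le_mul_of_nonneg_left (hy y)
            (Finset.prod_nonneg fun t _ => hq0 _ _)
      _ = ∑ t, ∑ i, q t i * bad t i + δ / 2 := by
          simp_rw [mul_add]
          rw [Finset.sum_add_distrib, ← Finset.sum_mul, sum_prod_eq_one hq1, one_mul]
          congr 1
          simp_rw [Finset.mul_sum]
          rw [Finset.sum_comm]
          exact Finset.sum_congr rfl fun t _ => sum_prod_apply hq1 t (bad t)
      _ ≤ ∑ t : Fin s, 1 / ρ + δ / 2 := by
          gcongr with t _
          exact sum_sample_small_le ha hacc (by positivity) t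
      _ = δ := by
          simp only [Finset.sum_const, Finset.card_univ, Fintype.card_fin, nsmul_eq_mul, hρ]
          field_simp
          ring
  set D : PMF (List (Round s n (Draws s k N))) := (tapes p (N + 1)).bind fun σ =>
    (V fun t => σ t 0).map (transcript k N Q (ε / 4) cp i₀ a est σ) with hD
  have hlaw : (sampler k N Q (ε / 4) cp i₀).law a est p 3 = D :=
    congrArg (PMF.bind (tapes p (N + 1))) (funext fun σ => run_sampler k N Q _ cp i₀ a est σ)
  refine le_of_le_of_eq ?_ (congrArg
    (fun D : PMF (List (Round s n (Draws s k N))) => D.toOuterMeasure S) hlaw).symm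
  refine (ENNReal.ofReal_le_ofReal (?_ : 1 - δ ≤ (D.toOuterMeasure S).toReal)).trans
    ENNReal.ofReal_toReal_le
  rw [← sum_tapes_slot hq1 F] at hfail
  have hreal : (D.toOuterMeasure S).toReal =
      ∑ σ, (tapes p (N + 1) σ).toReal * (1 - ∑ c, F (fun t => σ t 0) c
        (fun l => σ (slot c l).1 (slot c l).2)) := by
    rw [hD, PMF.toOuterMeasure_bind_apply, tsum_fintype (L := .unconditional _),
      ENNReal.toReal_sum]
    · refine Finset.sum_congr rfl fun σ _ => ?_
      rw [ENNReal.toReal_mul, PMF.toOuterMeasure_map_apply, toReal_toOuterMeasure_pmf]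
      congr 2
      refine Finset.sum_congr rfl fun c _ => ?_
      simp only [hF, Set.mem_preimage, hS, Set.mem_ofPred_eq, output_transcript]
      congr
    · intro σ _
      refine ENNReal.mul_ne_top (PMF.apply_ne_top _ _) ?_
      rw [PMF.toOuterMeasure_map_apply, PMF.toOuterMeasure_apply_fintype]
      refine ENNReal.sum_ne_top.2 fun c _ => ?_
      refine ne_top_of_le_ne_top (PMF.apply_ne_top (V fun t => σ t 0) c) ?_
      exact Set.indicator_le_self _ _ _
  rw [hreal]
  simp_rw [mul_sub, mul_one]
  rw [Finset.sum_sub_distrib, sum_toReal_pmf]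
  simp_rw [toReal_tapes]
  linarith

theorem words_le_of_mem_support {N : ℕ} {η : ℝ} {cp : Fin s} {i₀ : Fin n}
    {h : List (Round s n (Draws s k N))}
    (hh : h ∈ ((sampler k N Q η cp i₀).law a est p 3).support) :
    words cp h ≤ s * (Q + 2) + 2 * N + 2 * (N * (k + 1)) := by
  obtain ⟨σ, -, hσ⟩ := (PMF.mem_support_bind_iff _ _ _).1 hh
  obtain ⟨c, -, rfl⟩ := (PMF.mem_support_map_iff _ _ _).1
    ((Set.ext_iff.1 (congrArg PMF.support (run_sampler k N Q η cp i₀ a est σ)) h).1 hσ)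
  exact words_transcript_le k N Q η cp i₀ a est σ c

theorem words_eq_zero_of_one {Coin : Type} (hs : s = 1) (cp : Fin s)
    (h : List (Round s n Coin)) : words cp h = 0 := by
  subst hs
  have : (Finset.univ : Finset (Fin 1)).erase cp = ∅ := by
    ext t
    simp [Subsingleton.elim t cp]
  simp only [words, this, Finset.sum_empty]
  simp

end Access

/-! ### Parameters and conclusion. -/

/-- The number of words of the sampling protocol, for the parameters it is run with. -/
theorem words_bound {k s N Q : ℕ} {δ ε : ℝ} (hs : 2 ≤ s) (hδ : 0 < δ) (hδ1 : δ ≤ 1) (hε : 0 < ε)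
    (hε1 : ε < 1) (hN : (N : ℝ) ≤ 128 * (s : ℝ) ^ k / (δ * ε ^ 2) + 1)
    (hQ : (Q : ℝ) ≤ 16 * s / (δ * ε) + 1) :
    ((s * (Q + 2) + 2 * N + 2 * (N * (k + 1)) : ℕ) : ℝ) ≤
      8 * (19 + 129 * (2 * k + 4)) / δ *
        (((s : ℝ) ^ k + (s : ℝ) ^ 3) * (Real.log s / ε) ^ 3) := by
  have hs2 : (2 : ℝ) ≤ s := by exact_mod_cast hs
  have hs1 : (1 : ℝ) ≤ s := by linarith
  -- The logarithm is not needed for the cost: it is only bounded below, at the price of the factor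
  -- 8 in the constant.
  have hlog : 1 / 2 ≤ Real.log s :=
    le_trans (by have := Real.log_two_gt_d9; linarith) (Real.log_le_log (by norm_num) hs2)
  have hlog3 : 1 ≤ 8 * Real.log s ^ 3 := by
    have := pow_le_pow_left₀ (by norm_num) hlog 3
    linarith
  have hsk : (1 : ℝ) ≤ (s : ℝ) ^ k := one_le_pow₀ hs1
  have hs3 : (s : ℝ) * s ≤ (s : ℝ) ^ 3 := by
    rw [← sq]
    exact pow_le_pow_right₀ hs1 (by norm_num)
  have hε32 : ε ^ 3 ≤ ε ^ 2 := pow_le_pow_of_le_one hε.le hε1.le (by norm_num)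
  have hε31 : ε ^ 3 ≤ ε := pow_le_of_le_one hε.le hε1.le (by norm_num)
  have hD : 0 < δ * ε ^ 3 := by positivity
  have hD1 : δ * ε ^ 3 ≤ 1 := mul_le_one₀ hδ1 (by positivity) (hε31.trans hε1.le)
  -- This absorbs the additive constants: 129 is `128 + 1` and 19 is `16 + 1 + 2`.
  have hone : 1 ≤ 1 / (δ * ε ^ 3) := by rwa [le_div_iff₀ hD, one_mul]
  have hN2 : (N : ℝ) ≤ 129 * ((s : ℝ) ^ k / (δ * ε ^ 3)) := by
    have h1 : 128 * (s : ℝ) ^ k / (δ * ε ^ 2) ≤ 128 * (s : ℝ) ^ k / (δ * ε ^ 3) := by gcongr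
    have h2 : 1 ≤ (s : ℝ) ^ k / (δ * ε ^ 3) := hone.trans (by gcongr)
    rw [mul_div_assoc] at h1 hN
    rw [mul_div_assoc] at h1
    linarith
  have hQ2 : (s : ℝ) * (Q + 2) ≤ 19 * ((s : ℝ) ^ 3 / (δ * ε ^ 3)) := by
    have h1 : 16 * (s : ℝ) / (δ * ε) ≤ 16 * s / (δ * ε ^ 3) := by gcongr
    have h2 : 1 ≤ (s : ℝ) / (δ * ε ^ 3) := hone.trans (by gcongr)
    rw [mul_div_assoc] at h1 hQ
    rw [mul_div_assoc] at h1
    have h3 : (Q : ℝ) + 2 ≤ 19 * (s / (δ * ε ^ 3)) := by linarith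
    calc (s : ℝ) * (Q + 2) ≤ s * (19 * (s / (δ * ε ^ 3))) := by gcongr
      _ = 19 * ((s * s) / (δ * ε ^ 3)) := by ring
      _ ≤ _ := by gcongr
  set u := (s : ℝ) ^ k / (δ * ε ^ 3) with hu
  set v := (s : ℝ) ^ 3 / (δ * ε ^ 3) with hv
  have hu0 : 0 ≤ u := by positivity
  have hv0 : 0 ≤ v := by positivity
  have hk : (0 : ℝ) ≤ k := Nat.cast_nonneg k
  push_cast
  calc (s : ℝ) * (Q + 2) + 2 * N + 2 * (N * (k + 1)) = s * (Q + 2) + N * (2 * k + 4) := by ring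
    _ ≤ 19 * v + 129 * u * (2 * k + 4) := by gcongr
    _ ≤ (19 + 129 * (2 * k + 4)) * (u + v) := by nlinarith [mul_nonneg hk hv0]
    _ = (19 + 129 * (2 * k + 4)) / δ * (((s : ℝ) ^ k + (s : ℝ) ^ 3) / ε ^ 3) * 1 := by
        rw [hu, hv]
        field_simp
    _ ≤ (19 + 129 * (2 * k + 4)) / δ * (((s : ℝ) ^ k + (s : ℝ) ^ 3) / ε ^ 3) *
        (8 * Real.log s ^ 3) := by gcongr
    _ = _ := by
        field_simp

end FreqMoment

end

theorem theorem5 :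
    ∃ R : ℕ, ∀ k : ℕ, 1 ≤ k → ∀ δ : ℝ, 0 < δ → ∃ C : ℝ,
      ∀ (s n : ℕ) (cp : Fin s) (ε : ℝ), 0 < ε → ε < 1 →
        ∃ P : FreqMoment.Protocol s n,
          ∀ (a : Fin s → Fin n → ℝ), (∀ t i, 0 ≤ a t i) →
            ∀ (est : Fin s → ℝ) (p : Fin s → PMF (Fin n)),
              FreqMoment.IsAccess k (ε / 2) a est p →
                ENNReal.ofReal (1 - δ) ≤
                    (P.law a est p R).toOuterMeasure
                      {h | |P.output h - FreqMoment.moment k a| ≤ ε * FreqMoment.moment k a} ∧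
                ∀ h ∈ (P.law a est p R).support,
                  (FreqMoment.words cp h : ℝ) ≤
                      C * (((s : ℝ) ^ (k - 1) + (s : ℝ) ^ 3) * (Real.log s / ε) ^ 3) ∧
                  (4 ≤ k →
                    (FreqMoment.words cp h : ℝ) ≤
                      C * ((s : ℝ) ^ (k - 1) * (Real.log s) ^ 3 / ε ^ 3)) := by
  refine ⟨3, fun K hK δ hδ => ?_⟩
  obtain ⟨k, rfl⟩ : ∃ k, K = k + 1 := ⟨K - 1, by omega⟩
  simp only [Nat.add_sub_cancel]
  -- The word bound needs a failure probability at most 1.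
  set δ' := min δ 1 with hδ'
  have hδ0 : 0 < δ' := lt_min hδ one_pos
  set C : ℝ := 8 * (19 + 129 * (2 * k + 4)) / δ' with hC
  have hC0 : 0 ≤ C := by positivity
  -- The factor 2 absorbs `s ^ 3 ≤ s ^ k` in the last bound.
  refine ⟨2 * C, fun s n cp ε hε hε1 => ?_⟩
  have hs1 : (1 : ℝ) ≤ s := by exact_mod_cast cp.pos
  set N := ⌈128 * (s : ℝ) ^ k / (δ' * ε ^ 2)⌉₊ with hN
  set Q := ⌈16 * (s : ℝ) / (δ' * ε)⌉₊ with hQ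
  have hN0 : 0 < N := Nat.ceil_pos.2 (by positivity)
  have hNl : 128 * (s : ℝ) ^ k / (δ' * ε ^ 2) ≤ N := Nat.le_ceil _
  rw [div_le_iff₀ (by positivity), ← mul_assoc] at hNl
  rcases Nat.eq_zero_or_pos n with rfl | hn
  -- There is no probability law on `Fin 0`, so any protocol will do.
  · refine ⟨⟨Unit, 0, fun _ => PMF.pure (), fun _ _ _ => [], fun _ _ _ _ => [], fun _ => 0⟩,
      fun a _ est p _ => ?_⟩
    obtain ⟨i, -⟩ := (p cp).support_nonempty
    exact i.elim0
  refine ⟨FreqMoment.sampler k N Q (ε / 4) cp ⟨0, hn⟩, fun a ha est p hacc => ⟨?_, fun h hh => ?_⟩⟩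
  · exact (ENNReal.ofReal_le_ofReal (sub_le_sub_left (min_le_left δ 1) 1)).trans
      (FreqMoment.le_law_sampler ha hε hε1 hδ0 hacc hN0 hNl (Nat.le_ceil _) cp _)
  · rcases (show 1 ≤ s from cp.pos).eq_or_lt with hs | hs
    -- Here `Real.log s = 0`, so the bound is 0; the only server is the one at the CP.
    · rw [FreqMoment.words_eq_zero_of_one hs.symm cp h, ← hs]
      simp
    · have h1 : (FreqMoment.words cp h : ℝ) ≤
          C * (((s : ℝ) ^ k + (s : ℝ) ^ 3) * (Real.log s / ε) ^ 3) :=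
        (Nat.cast_le.2 (FreqMoment.words_le_of_mem_support hh)).trans
          (FreqMoment.words_bound hs hδ0 (min_le_right δ 1) hε hε1
            (Nat.ceil_lt_add_one (by positivity)).le (Nat.ceil_lt_add_one (by positivity)).le)
      have hlog : 0 ≤ Real.log s := Real.log_nonneg hs1
      refine ⟨h1.trans ?_, fun hk => h1.trans ?_⟩
      · exact mul_le_mul_of_nonneg_right (by linarith) (by positivity)
      · have h3 : (s : ℝ) ^ 3 ≤ (s : ℝ) ^ k := pow_le_pow_right₀ hs1 (by omega)
        calc _ ≤ C * (((s : ℝ) ^ k + (s : ℝ) ^ k) * (Real.log s / ε) ^ 3) := by gcongr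
          _ = _ := by
            rw [div_pow]
            ring
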